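/- Let $p$ be a prime, let $V_5^*$ be the $\mathbf{F}_p$-vector space of binary quintic forms (homogeneous polynomials of degree $5$ in $x,y$ over $\mathbf{F}_p$, including $0$), and let $V_5$ be its dual space, with natural pairing $(\cdot,\cdot)\colon V_5\times V_5^*\to\mathbf{F}_p$. Call $v\in V_5^*$ singular if it has a multiple factor, i.e. if it is divisible by the square of a nonconstant polynomial (equivalently, $\mathrm{Disc}(v)=0$); in particular $v=0$ is singular. For $w\in V_5$ put \[ \widehat{\Phi}(w)=\frac{1}{\#V_5^*}\sum_{\substack{v\in V_5^*\\ v\text{ singular}}}\exp\left(\frac{2\pi i\,(w,v)}{p}\right), \] put $a_j=(w,x^{5-j}y^j)$ for $0\le j\le 5$, and let \[ \mathrm{Cat}_{2,2}(x,y:w)=\det\left(x\begin{pmatrix}a_1&a_2&a_3\\a_2&a_3&a_4\\a_3&a_4&a_5\end{pmatrix}-y\begin{pmatrix}a_0&a_1&a_2\\a_1&a_2&a_3\\a_2&a_3&a_4\end{pmatrix}\right)\in\mathbf{F}_p[x,y] \] be the catalecticant covariant of $w$. Theorem. Let $0\ne w\in V_5$, and suppose that $\mathrm{Cat}_{2,2}(x,y:w)$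 is not the zero polynomial. Then $\widehat{\Phi}(w)=C(w)\,p^{-4}$ for an integer $C(w)$ with $|C(w)|\le 4$. If $p=2$, then moreover $|C(w)|\le 2$. -/

import Mathlib

/-- `V_n^*`: binary forms of degree `n` over `𝔽_p`, in the variables `x = X 0`, `y = X 1`. -/
abbrev BinaryForm (p n : ℕ) : Type :=
  MvPolynomial.homogeneousSubmodule (Fin 2) (ZMod p) n

/-- `V_n`: the dual space of the space of binary forms of degree `n`. The natural pairing
`(w, v)` of `w ∈ V_n` with `v ∈ V_n^*` is the evaluation `w v`. -/
abbrev DualForm (p n : ℕ) : Type :=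
  Module.Dual (ZMod p) (BinaryForm p n)

instance BinaryForm.instFinite (p n : ℕ) [Fact p.Prime] : Finite (BinaryForm p n) := by
  have : Module.Finite (ZMod p) (BinaryForm p n) :=
    Module.Finite.iff_fg.mpr (MvPolynomial.homogeneousSubmodule_fg (Fin 2) (ZMod p) n)
  exact Module.finite_of_finite (ZMod p)

noncomputable instance BinaryForm.instFintype (p n : ℕ) [Fact p.Prime] :
    Fintype (BinaryForm p n) :=
  Fintype.ofFinite _

/-- The standard basis form `x ^ (n - j) * y ^ j`, for `0 ≤ j ≤ n`. -/
noncomputable def BinaryForm.stdMonomial (p n : ℕ) (j : Fin (n + 1)) : BinaryForm p n :=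
  ⟨MvPolynomial.X 0 ^ (n - (j : ℕ)) * MvPolynomial.X 1 ^ (j : ℕ), by
    have h := (MvPolynomial.isHomogeneous_X_pow (R := ZMod p) (0 : Fin 2) (n - (j : ℕ))).mul
      (MvPolynomial.isHomogeneous_X_pow (R := ZMod p) (1 : Fin 2) (j : ℕ))
    rwa [Nat.sub_add_cancel (Nat.lt_succ_iff.mp j.isLt)] at h⟩

/-- A binary form is singular if it has a multiple factor, that is, it is divisible by the square
of a nonunit. The zero form is singular. -/
def BinaryForm.IsSingular {p n : ℕ} (v : BinaryForm p n) : Prop :=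
  ¬ Squarefree (v : MvPolynomial (Fin 2) (ZMod p))

open Classical in
/-- The indicator function `Φ` of the singular binary forms. -/
noncomputable def singularIndicator {p n : ℕ} (v : BinaryForm p n) : ℂ :=
  if v.IsSingular then 1 else 0

/-- The exponential sum
`Φ̂(w) = (1 / #V_n^*) * ∑_{v ∈ V_n^*} Φ(v) * exp (2 π i (w, v) / p)`. -/
noncomputable def singularExpSum {p n : ℕ} [Fact p.Prime] (w : DualForm p n) : ℂ :=
  (1 / (Fintype.card (BinaryForm p n) : ℂ)) *
    ∑ v : BinaryForm p n, singularIndicator v *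
      Complex.exp (2 * (Real.pi : ℂ) * Complex.I * ((w v).val : ℂ) / (p : ℂ))

/-- The coordinate `a_j = (w, x ^ (n - j) * y ^ j)` of `w` with respect to the basis dual to the
standard one. -/
noncomputable def DualForm.coord {p n : ℕ} (w : DualForm p n) (j : Fin (n + 1)) : ZMod p :=
  w (BinaryForm.stdMonomial p n j)

/-- The catalecticant matrix `A_{s,t;r}(w)`, of size `(t + 1) × (s + 1)`, with entry `a_{r+i+j}`
in row `i` and column `j`. -/
noncomputable def DualForm.catMatrix {p n : ℕ} (w : DualForm p n) (s t r : ℕ)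
    (h : r + s + t ≤ n) : Matrix (Fin (t + 1)) (Fin (s + 1)) (ZMod p) :=
  Matrix.of fun i j => w.coord ⟨r + (i : ℕ) + (j : ℕ), by omega⟩

/-- The catalecticant covariant `Cat_{m,m}(x, y : w) = det (A_{m,m;1}(w) x - A_{m,m;0}(w) y)` of
`w ∈ V_{2m+1}`, a polynomial in `x = X 0` and `y = X 1`. -/
noncomputable def DualForm.catCovariant {p : ℕ} (m : ℕ) (w : DualForm p (2 * m + 1)) :
    MvPolynomial (Fin 2) (ZMod p) :=
  Matrix.det
    ((MvPolynomial.X 0 : MvPolynomial (Fin 2) (ZMod p)) •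
        (w.catMatrix m m 1 (by omega)).map MvPolynomial.C -
      (MvPolynomial.X 1 : MvPolynomial (Fin 2) (ZMod p)) •
        (w.catMatrix m m 0 (by omega)).map MvPolynomial.C)

/-! A nonzero quintic `v` has a form `d` of degree at most 2 such that `e ^ 2 ∣ v` iff `e ∣ d`.
Hence the indicator of singular forms is L + Q - P, where L, Q and P count the linear classes, the
quadratic classes and the ordered pairs of linear classes whose square (or squared product) divides
`v` (`BinaryForm.isSingular_eq_card`). The multiples of a fixed `d ^ 2` form a subspace, so by
orthogonality of characters each term contributes its size if `w` kills it and 0 otherwise. This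
gives Φ̂(w) = p⁻⁴ (p² L(w) + Q(w) - P(w)), where the counts now run over killed classes
(`singularExpSum_eq_card`). A killed linear class gives a common kernel vector of the two Hankel
matrices, which would make the catalecticant covariant vanish; so L(w) = 0. Grouping pairs by their
product, Q(w) - P(w) is the sum of 1 - #{linear divisors of `q`} over killed quadratic `q`. Each
term is 1, 0 or -1, so it suffices to count killed `q` whose number of linear divisors is not 1. A
killed `q` is a common zero in the projective plane of the two Hankel conics. For odd p,
nondegeneracy of the pencil forbids three collinear common zeros, and five in general position would
make the matrices proportional, hence the covariant zero; so there are at most four. For p = 2 the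
conics become linear on F₂-points, so killed `q` lie on a line, and at most two points of it are not
squares of linear forms. -/

/-! ### Homogeneous factors and square divisors. -/

open MvPolynomial in
/-- A factor of a nonzero homogeneous polynomial over a domain is homogeneous. -/
theorem MvPolynomial.IsHomogeneous.of_mul_left {σ R : Type*} [CommRing R] [IsDomain R]
    {f g : MvPolynomial σ R} {n : ℕ} (h : (f * g).IsHomogeneous n) (h0 : f * g ≠ 0) :
    f.IsHomogeneous f.totalDegree := by
  have hf := left_ne_zero_of_mul h0
  have hg := right_ne_zero_of_mul h0
  have ordle : ∀ q : MvPolynomial σ R, q ≠ 0 → (q : MvPowerSeries σ R).order ≤ q.totalDegree := by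
    intro q hq
    obtain ⟨d, hd⟩ := MvPolynomial.ne_zero_iff.mp hq
    refine (MvPowerSeries.order_le (d := d) (by simpa using hd)).trans ?_
    have := MvPolynomial.le_totalDegree (MvPolynomial.mem_support_iff.mpr hd)
    exact_mod_cast this
  have hn : f.totalDegree + g.totalDegree = n := by
    rw [← totalDegree_mul_of_isDomain hf hg, h.totalDegree h0]
  have hord : (n : ℕ∞) ≤ ((f * g : MvPolynomial σ R) : MvPowerSeries σ R).order := by
    refine MvPowerSeries.nat_le_order fun d hd => ?_
    rw [MvPolynomial.coeff_coe]
    exact h.coeff_eq_zero hd.ne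
  rw [MvPolynomial.coe_mul, MvPowerSeries.order_mul] at hord
  have h1 := ordle g hg
  -- Order and total degree are both additive, and order is at most total degree for each factor.
  -- The product has order at least its total degree `n`, so equality holds for `f` and all its
  -- monomials have the same degree.
  have h2 : (f.totalDegree : ℕ∞) ≤ (f : MvPowerSeries σ R).order := by
    have h3 : ((f.totalDegree : ℕ∞)) + g.totalDegree ≤
        (f : MvPowerSeries σ R).order + g.totalDegree := by
      calc ((f.totalDegree : ℕ∞)) + g.totalDegree = n := by exact_mod_cast hn
        _ ≤ _ := hord
        _ ≤ _ := by gcongr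
    exact (ENat.add_le_add_iff_right (ENat.natCast_ne_top _)).mp h3
  intro d hd'
  change Finsupp.weight (fun _ => 1) d = _
  rw [← Finsupp.degree_eq_weight_one]
  have h4 : (f.totalDegree : ℕ∞) ≤ d.degree :=
    h2.trans (MvPowerSeries.order_le (d := d) (by simpa using hd'))
  have h5 : d.degree ≤ f.totalDegree := MvPolynomial.le_totalDegree (MvPolynomial.mem_support_iff.mpr hd')
  exact le_antisymm h5 (by exact_mod_cast h4)

/-- In a unique factorization domain, the square divisors of a nonzero element are the squares of
the divisors of a single element. -/
theorem exists_forall_sq_dvd_iff_dvd {R : Type*} [CommRing R] [IsDomain R]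
    [UniqueFactorizationMonoid R] {v : R} (hv : v ≠ 0) :
    ∃ d, ∀ e, e ^ 2 ∣ v ↔ e ∣ d := by
  -- Write `v = d ^ 2 * m` with `m` minimal for divisibility; minimality makes `m` squarefree.
  obtain ⟨m, ⟨d, hd⟩, hmin⟩ := (wellFounded_dvdNotUnit (α := R)).has_min
    {m | ∃ d, v = d ^ 2 * m} ⟨v, 1, by simp⟩
  have hm : m ≠ 0 := by rintro rfl; simp [hd] at hv
  have hd0 : d ≠ 0 := by rintro rfl; simp [hd] at hv
  have hsq : Squarefree m := by
    rintro z ⟨m', rfl⟩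
    by_contra hz
    refine hmin m' ⟨d * z, by rw [hd]; ring⟩ ⟨right_ne_zero_of_mul hm, z * z, ?_, mul_comm _ _⟩
    exact fun h => hz (isUnit_of_mul_isUnit_left h)
  refine ⟨d, fun e => ⟨fun h => ?_, fun h => hd ▸ (pow_dvd_pow_of_dvd h 2).mul_right m⟩⟩
  obtain ⟨d', e', c, hrel, rfl, rfl⟩ := UniqueFactorizationMonoid.exists_reduced_factors d hd0 e
  have hc : c ^ 2 ≠ 0 := pow_ne_zero 2 (left_ne_zero_of_mul hd0)
  rw [hd, mul_pow, mul_pow, mul_assoc, mul_dvd_mul_iff_left hc] at h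
  have h2 : e' ^ 2 ∣ m := (hrel.symm.pow (m := 2) (n := 2)).dvd_of_dvd_mul_left h
  exact mul_dvd_mul_left c ((hsq e' (by rwa [← sq])).dvd)

/-! ### Coordinates and cardinality of the space of binary forms. -/

namespace BinaryForm

open MvPolynomial

variable {p : ℕ}

@[simp]
theorem coe_stdMonomial (n : ℕ) (j : Fin (n + 1)) :
    (stdMonomial p n j : MvPolynomial (Fin 2) (ZMod p)) = X 0 ^ (n - (j : ℕ)) * X 1 ^ (j : ℕ) :=
  rfl

/-- The form with given coordinates in the standard basis. -/
noncomputable def ofCoords (p n : ℕ) : (Fin (n + 1) → ZMod p) →ₗ[ZMod p] BinaryForm p n :=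
  Fintype.linearCombination (ZMod p) (stdMonomial p n)

theorem ofCoords_apply (n : ℕ) (c : Fin (n + 1) → ZMod p) :
    ofCoords p n c = ∑ j, c j • stdMonomial p n j :=
  rfl

theorem stdMonomial_eq_monomial (n : ℕ) (j : Fin (n + 1)) :
    (stdMonomial p n j : MvPolynomial (Fin 2) (ZMod p)) =
      monomial (Finsupp.single 0 (n - (j : ℕ)) + Finsupp.single 1 (j : ℕ)) 1 := by
  rw [coe_stdMonomial, X_pow_eq_monomial, X_pow_eq_monomial, monomial_mul, one_mul]

theorem coeff_ofCoords (n : ℕ) (c : Fin (n + 1) → ZMod p) (j : Fin (n + 1)) :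
    (ofCoords p n c : MvPolynomial (Fin 2) (ZMod p)).coeff
      (Finsupp.single 0 (n - (j : ℕ)) + Finsupp.single 1 (j : ℕ)) = c j := by
  rw [ofCoords_apply, Submodule.coe_sum, coeff_sum, Finset.sum_eq_single j]
  · rw [Submodule.coe_smul, stdMonomial_eq_monomial, coeff_smul, coeff_monomial]
    simp
  · intro i _ hij
    rw [Submodule.coe_smul, stdMonomial_eq_monomial, coeff_smul, coeff_monomial, if_neg, smul_zero]
    intro h
    have := DFunLike.congr_fun h 1
    simp at this
    exact hij (Fin.ext this)
  · simp

theorem ofCoords_bijective (n : ℕ) : Function.Bijective (ofCoords p n) := by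
  constructor
  · intro c c' h
    ext j
    rw [← coeff_ofCoords n c j, h, coeff_ofCoords]
  · intro v
    refine ⟨fun j => (v : MvPolynomial (Fin 2) (ZMod p)).coeff
      (Finsupp.single 0 (n - (j : ℕ)) + Finsupp.single 1 (j : ℕ)), Subtype.ext ?_⟩
    ext d
    by_cases hd : d.degree = n
    · have hd' : d 0 + d 1 = n := by
        rw [← hd, Finsupp.degree_eq_sum, Fin.sum_univ_two]
      have : d = Finsupp.single 0 (n - d 1) + Finsupp.single 1 (d 1) := by
        ext i
        fin_cases i <;> simp; omega
      have key := coeff_ofCoords (p := p) n (fun j => (v : MvPolynomial (Fin 2) (ZMod p)).coeff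
        (Finsupp.single 0 (n - (j : ℕ)) + Finsupp.single 1 (j : ℕ))) ⟨d 1, by omega⟩
      simp only [] at key
      rw [← this] at key
      exact key
    · rw [IsHomogeneous.coeff_eq_zero (ofCoords p n _).2 hd, IsHomogeneous.coeff_eq_zero v.2 hd]

/-- The coordinates of a binary form in the standard basis. -/
noncomputable def coordEquiv (p n : ℕ) : BinaryForm p n ≃ₗ[ZMod p] (Fin (n + 1) → ZMod p) :=
  (LinearEquiv.ofBijective (ofCoords p n) (ofCoords_bijective n)).symm

theorem eq_sum_coordEquiv (n : ℕ) (v : BinaryForm p n) :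
    v = ∑ j, coordEquiv p n v j • stdMonomial p n j :=
  ((LinearEquiv.ofBijective (ofCoords p n) (ofCoords_bijective n)).apply_symm_apply v).symm

variable [Fact p.Prime]

theorem finrank_eq (n : ℕ) : Module.finrank (ZMod p) (BinaryForm p n) = n + 1 := by
  rw [(coordEquiv p n).finrank_eq]
  simp

theorem card_eq (n : ℕ) : Fintype.card (BinaryForm p n) = p ^ (n + 1) := by
  rw [Fintype.card_congr (coordEquiv p n).toEquiv]
  simp [ZMod.card]

end BinaryForm

/-! ### Inclusion–exclusion over square divisors. -/

section

open LinearAlgebra.Projectivization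

/-- Nonzero binary forms of degree `n` up to scalars. -/
abbrev FormClass (p n : ℕ) [Fact p.Prime] : Type :=
  ℙ (ZMod p) (BinaryForm p n)

namespace FormClass

open MvPolynomial Finset

variable {p n : ℕ} [Fact p.Prime]

noncomputable instance instFintype : Fintype (FormClass p n) :=
  Fintype.ofFinite _

/-- A polynomial representing a class of binary forms. -/
noncomputable def form (q : FormClass p n) : MvPolynomial (Fin 2) (ZMod p) :=
  q.rep

theorem form_ne_zero (q : FormClass p n) : q.form ≠ 0 :=
  fun h => q.rep_nonzero (Subtype.ext h)

theorem form_isHomogeneous (q : FormClass p n) : q.form.IsHomogeneous n :=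
  q.rep.2

theorem totalDegree_form (q : FormClass p n) : q.form.totalDegree = n :=
  q.form_isHomogeneous.totalDegree q.form_ne_zero

theorem card_eq : Fintype.card (FormClass p n) = ∑ i ∈ range (n + 1), p ^ i := by
  rw [← Nat.card_eq_fintype_card,
    Projectivization.card_of_finrank _ _ (BinaryForm.finrank_eq (p := p) n), Nat.card_zmod]

theorem form_dvd_iff (q : FormClass p n) {b : BinaryForm p n} (hb : b ≠ 0) :
    q.form ∣ (b : MvPolynomial (Fin 2) (ZMod p)) ↔ q = Projectivization.mk _ b hb := by
  have hb' : (b : MvPolynomial (Fin 2) (ZMod p)) ≠ 0 := fun h => hb (Subtype.ext h)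
  constructor
  · rintro ⟨c, hc⟩
    have hc0 : c ≠ 0 := by rintro rfl; simp [hc] at hb'
    have hdeg := congrArg totalDegree hc
    rw [totalDegree_mul_of_isDomain q.form_ne_zero hc0, q.totalDegree_form,
      IsHomogeneous.totalDegree b.2 hb'] at hdeg
    have hcC := totalDegree_eq_zero_iff_eq_C.mp (show c.totalDegree = 0 by omega)
    rw [← q.mk_rep]
    refine ((Projectivization.mk_eq_mk_iff' _ _ _ _ _).mpr ⟨c.coeff 0, Subtype.ext ?_⟩).symm
    rw [Submodule.coe_smul, hc, smul_eq_C_mul, ← hcC, mul_comm]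
    rfl
  · rintro rfl
    obtain ⟨a, ha⟩ := Projectivization.exists_smul_eq_mk_rep (ZMod p) b hb
    refine ⟨C (↑a⁻¹ : ZMod p), ?_⟩
    rw [form, ← ha, Units.smul_def, Submodule.coe_smul, mul_comm, smul_eq_C_mul, ← mul_assoc,
      ← C_mul, Units.inv_mul, C_1, one_mul]

theorem exists_form_dvd_iff {d : MvPolynomial (Fin 2) (ZMod p)} (hd : d.IsHomogeneous n)
    (h0 : d ≠ 0) : ∃ D : FormClass p n, ∀ q : FormClass p n, q.form ∣ d ↔ q = D :=
  ⟨Projectivization.mk _ (⟨d, hd⟩ : BinaryForm p n) (fun h => h0 (congrArg Subtype.val h)),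
    fun q => q.form_dvd_iff (b := ⟨d, hd⟩) _⟩

theorem le_totalDegree_of_dvd {d : MvPolynomial (Fin 2) (ZMod p)} (h0 : d ≠ 0)
    {q : FormClass p n} (h : q.form ∣ d) : n ≤ d.totalDegree :=
  q.totalDegree_form ▸ totalDegree_le_of_dvd_of_isDomain h h0

-- Once a linear factor of a quadratic form is chosen, the cofactor is linear and its class is
-- determined, so an ordered pair is determined by its first entry.
open Classical in
theorem card_pairs_dvd_quadratic {d : MvPolynomial (Fin 2) (ZMod p)} (hd : d.IsHomogeneous 2)
    (h0 : d ≠ 0) :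
    #{x : FormClass p 1 × FormClass p 1 | x.1.form * x.2.form ∣ d} =
      #{l : FormClass p 1 | l.form ∣ d} := by
  have key : ∀ l : FormClass p 1, l.form ∣ d →
      ∃ D : FormClass p 1, ∀ m : FormClass p 1, l.form * m.form ∣ d ↔ m = D := by
    rintro l ⟨c, rfl⟩
    have hc0 := right_ne_zero_of_mul h0
    have hdeg : c.totalDegree = 1 := by
      have := totalDegree_mul_of_isDomain l.form_ne_zero hc0
      rw [hd.totalDegree h0, l.totalDegree_form] at this
      omega
    have hc : c.IsHomogeneous 1 := by
      rw [← hdeg]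
      exact IsHomogeneous.of_mul_left (g := l.form) (n := 2) (by rwa [mul_comm])
        (by rwa [mul_comm])
    obtain ⟨D, hD⟩ := exists_form_dvd_iff hc hc0
    exact ⟨D, fun m => by rw [mul_dvd_mul_iff_left l.form_ne_zero, hD]⟩
  refine card_bij (fun x _ => x.1) ?_ ?_ ?_
  · intro x hx
    simp only [mem_filter, mem_univ, true_and] at hx ⊢
    exact dvd_of_mul_right_dvd hx
  · rintro ⟨l, m⟩ h ⟨l', m'⟩ h' e
    simp only [mem_filter, mem_univ, true_and] at h h' e
    subst e
    obtain ⟨D, hD⟩ := key l (dvd_of_mul_right_dvd h)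
    rw [(hD m).mp h, (hD m').mp h']
  · intro l hl
    simp only [mem_filter, mem_univ, true_and] at hl
    obtain ⟨D, hD⟩ := key l hl
    exact ⟨(l, D), by simpa using (hD D).mpr rfl, rfl⟩

theorem two_le_totalDegree_of_mul_form_dvd {d : MvPolynomial (Fin 2) (ZMod p)} (h0 : d ≠ 0)
    {x : FormClass p 1 × FormClass p 1} (h : x.1.form * x.2.form ∣ d) : 2 ≤ d.totalDegree := by
  have := totalDegree_le_of_dvd_of_isDomain h h0
  rwa [totalDegree_mul_of_isDomain x.1.form_ne_zero x.2.form_ne_zero, totalDegree_form,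
    totalDegree_form] at this

open Classical in
/-- Inclusion–exclusion over the classes of linear and quadratic forms dividing a form of degree
at most two. -/
theorem card_divisors_of_totalDegree_le_two {d : MvPolynomial (Fin 2) (ZMod p)} (h0 : d ≠ 0)
    (hd : d.IsHomogeneous d.totalDegree) (hle : d.totalDegree ≤ 2) :
    (#{l : FormClass p 1 | l.form ∣ d} + #{q : FormClass p 2 | q.form ∣ d} -
      #{x : FormClass p 1 × FormClass p 1 | x.1.form * x.2.form ∣ d} : ℤ) =
      if IsUnit d then 0 else 1 := by
  have hunit : IsUnit d ↔ d.totalDegree = 0 := by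
    rw [isUnit_iff_totalDegree_of_isReduced]
    refine ⟨fun h => h.2, fun h => ⟨?_, h⟩⟩
    rw [totalDegree_eq_zero_iff_eq_C.mp h] at h0
    exact isUnit_iff_ne_zero.mpr fun h' => h0 (by rw [h', C_0])
  have hcases : d.totalDegree = 0 ∨ d.totalDegree = 1 ∨ d.totalDegree = 2 := by omega
  have empty_of : ∀ m, d.totalDegree < m → #{q : FormClass p m | q.form ∣ d} = 0 := by
    intro m hm
    rw [card_eq_zero, filter_eq_empty_iff]
    intro q _ h
    have := le_totalDegree_of_dvd h0 h
    omega
  have one_of : ∀ m, d.totalDegree = m → #{q : FormClass p m | q.form ∣ d} = 1 := by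
    rintro m rfl
    obtain ⟨D, hD⟩ := exists_form_dvd_iff hd h0
    exact card_eq_one.mpr ⟨D, by ext q; simp [hD]⟩
  have pair_of : d.totalDegree < 2 →
      #{x : FormClass p 1 × FormClass p 1 | x.1.form * x.2.form ∣ d} = 0 := by
    intro hm
    rw [card_eq_zero, filter_eq_empty_iff]
    intro x _ h
    have := two_le_totalDegree_of_mul_form_dvd h0 h
    omega
  simp only [hunit]
  rcases hcases with h | h | h
  · rw [empty_of 1 (by omega), empty_of 2 (by omega), pair_of (by omega), h]
    simp
  · rw [one_of 1 h, empty_of 2 (by omega), pair_of (by omega), h]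
    simp
  · rw [h] at hd
    rw [one_of 2 h, card_pairs_dvd_quadratic hd h0, h]
    simp

end FormClass

-- The square divisors of `v ≠ 0` are governed by the divisors of one form `d`, with `2 * deg d ≤
-- 5`, so inclusion–exclusion stops at degree two.
open MvPolynomial Finset in
open Classical in
theorem BinaryForm.isSingular_eq_card {p : ℕ} [Fact p.Prime] (v : BinaryForm p 5) :
    (if v.IsSingular then 1 else 0 : ℤ) =
      #{l : FormClass p 1 | l.form ^ 2 ∣ (v : MvPolynomial (Fin 2) (ZMod p))} +
      #{q : FormClass p 2 | q.form ^ 2 ∣ (v : MvPolynomial (Fin 2) (ZMod p))} -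
      #{x : FormClass p 1 × FormClass p 1 |
        (x.1.form * x.2.form) ^ 2 ∣ (v : MvPolynomial (Fin 2) (ZMod p))} := by
  by_cases hv : (v : MvPolynomial (Fin 2) (ZMod p)) = 0
  · have : v.IsSingular := by simp [IsSingular, hv]
    -- For `v = 0` every class counts: (p + 1) + (p² + p + 1) - (p + 1)² = 1.
    simp [this, hv, FormClass.card_eq, Finset.sum_range_succ]
    ring
  · obtain ⟨d, hd⟩ := exists_forall_sq_dvd_iff_dvd hv
    obtain ⟨m, hm⟩ := (hd d).mpr dvd_rfl
    have hd0 : d ≠ 0 := by rintro rfl; simp [hm] at hv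
    have hm0 : m ≠ 0 := by rintro rfl; simp [hm] at hv
    have hm' : (v : MvPolynomial (Fin 2) (ZMod p)) = d * (d * m) := by rw [hm]; ring
    have hhom : d.IsHomogeneous d.totalDegree :=
      IsHomogeneous.of_mul_left (g := d * m) (n := 5) (hm' ▸ v.2) (hm' ▸ hv)
    have hle : d.totalDegree ≤ 2 := by
      have := IsHomogeneous.totalDegree v.2 hv
      rw [hm', totalDegree_mul_of_isDomain hd0 (mul_ne_zero hd0 hm0),
        totalDegree_mul_of_isDomain hd0 hm0] at this
      omega
    simp only [hd]
    rw [FormClass.card_divisors_of_totalDegree_le_two hd0 hhom hle]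
    have hsing : v.IsSingular ↔ ¬ IsUnit d := by
      rw [IsSingular, not_iff_not]
      constructor
      · intro h
        exact h d (by rw [← sq]; exact (hd d).mpr dvd_rfl)
      · intro h z hz
        exact isUnit_of_dvd_unit ((hd z).mp (by rwa [sq])) h
    by_cases h : IsUnit d <;> simp [hsing, h]

end

/-! ### Fourier transform of the singular indicator. -/

section

open MvPolynomial

variable {p : ℕ}

/-- Multiplication by the square of a form of degree `k`, as a linear map between spaces of binary
forms. -/
noncomputable def BinaryForm.sqMul {k j n : ℕ} (d : MvPolynomial (Fin 2) (ZMod p))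
    (hd : d.IsHomogeneous k) (h : k * 2 + j = n) : BinaryForm p j →ₗ[ZMod p] BinaryForm p n :=
  ((LinearMap.mulLeft (ZMod p) (d ^ 2)).comp (Submodule.subtype _)).codRestrict _
    fun f => h ▸ (hd.pow 2).mul f.2

theorem BinaryForm.coe_sqMul {k j n : ℕ} (d : MvPolynomial (Fin 2) (ZMod p))
    (hd : d.IsHomogeneous k) (h : k * 2 + j = n) (f : BinaryForm p j) :
    (BinaryForm.sqMul d hd h f : MvPolynomial (Fin 2) (ZMod p)) = d ^ 2 * f :=
  rfl

/-- A functional on binary forms kills all multiples of `d ^ 2`. -/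
def DualForm.KillsSq {n : ℕ} (w : DualForm p n) (d : MvPolynomial (Fin 2) (ZMod p)) : Prop :=
  ∀ v : BinaryForm p n, d ^ 2 ∣ (v : MvPolynomial (Fin 2) (ZMod p)) → w v = 0

variable [Fact p.Prime]

theorem BinaryForm.sqMul_injective {k j n : ℕ} {d : MvPolynomial (Fin 2) (ZMod p)} (h0 : d ≠ 0)
    (hd : d.IsHomogeneous k) (h : k * 2 + j = n) :
    Function.Injective (BinaryForm.sqMul d hd h) := by
  intro f g hfg
  have := congrArg Subtype.val hfg
  rw [coe_sqMul, coe_sqMul] at this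
  exact Subtype.ext (mul_left_cancel₀ (pow_ne_zero 2 h0) this)

theorem BinaryForm.exists_sqMul_eq {k j n : ℕ} {d : MvPolynomial (Fin 2) (ZMod p)} (h0 : d ≠ 0)
    (hd : d.IsHomogeneous k) (h : k * 2 + j = n) {v : BinaryForm p n}
    (hv : d ^ 2 ∣ (v : MvPolynomial (Fin 2) (ZMod p))) : ∃ f, sqMul d hd h f = v := by
  obtain ⟨c, hc⟩ := hv
  by_cases hc0 : c = 0
  · exact ⟨0, by rw [map_zero]; exact Subtype.ext (by rw [hc, hc0, mul_zero]; rfl)⟩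
  · have hhom : (c * d ^ 2).IsHomogeneous n := by rw [mul_comm, ← hc]; exact v.2
    have hne := mul_ne_zero hc0 (pow_ne_zero 2 h0)
    have hdeg := hhom.totalDegree hne
    rw [totalDegree_mul_of_isDomain hc0 (pow_ne_zero 2 h0),
      (hd.pow 2).totalDegree (pow_ne_zero 2 h0)] at hdeg
    have hj : c.totalDegree = j := by omega
    exact ⟨⟨c, hj ▸ hhom.of_mul_left hne⟩, Subtype.ext hc.symm⟩

open Classical in
/-- The Fourier transform of the indicator function of the multiples of `d ^ 2`. -/
theorem sum_sq_dvd_stdAddChar {k j n : ℕ} (w : DualForm p n) {d : MvPolynomial (Fin 2) (ZMod p)}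
    (h0 : d ≠ 0) (hd : d.IsHomogeneous k) (h : k * 2 + j = n) :
    ∑ v : BinaryForm p n, (if d ^ 2 ∣ (v : MvPolynomial (Fin 2) (ZMod p)) then (1 : ℂ) else 0) *
      ZMod.stdAddChar (w v) = if w.KillsSq d then (p : ℂ) ^ (j + 1) else 0 := by
  have hkill : w.KillsSq d ↔ ∀ f, w (BinaryForm.sqMul d hd h f) = 0 := by
    constructor
    · exact fun hw f => hw _ (Dvd.intro _ rfl)
    · intro hw v hv
      obtain ⟨f, rfl⟩ := BinaryForm.exists_sqMul_eq h0 hd h hv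
      exact hw f
  let ψ : AddChar (BinaryForm p j) ℂ :=
    ZMod.stdAddChar.compAddMonoidHom (w ∘ₗ BinaryForm.sqMul d hd h).toAddMonoidHom
  have hψ : ψ = 0 ↔ w.KillsSq d := by
    rw [hkill]
    constructor
    · intro h' f
      have := DFunLike.congr_fun h' f
      exact ZMod.injective_stdAddChar (this.trans (AddChar.map_zero_eq_one _).symm)
    · intro h'
      ext f
      change ZMod.stdAddChar (w (BinaryForm.sqMul d hd h f)) = 1
      rw [h', AddChar.map_zero_eq_one]
  have hsum := AddChar.sum_eq_ite ψ
  rw [BinaryForm.card_eq, Nat.cast_pow] at hsum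
  simp only [hψ] at hsum
  rw [← hsum]
  simp only [ite_mul, one_mul, zero_mul]
  rw [← Finset.sum_filter]
  symm
  refine Finset.sum_bij (fun f _ => BinaryForm.sqMul d hd h f) ?_ ?_ ?_ ?_
  · intro f _
    simpa using Dvd.intro _ (BinaryForm.coe_sqMul d hd h f).symm
  · exact fun f _ g _ e => BinaryForm.sqMul_injective h0 hd h e
  · intro v hv
    obtain ⟨f, hf⟩ := BinaryForm.exists_sqMul_eq h0 hd h (Finset.mem_filter.mp hv).2
    exact ⟨f, Finset.mem_univ _, hf⟩
  · exact fun f _ => rfl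

theorem singularExpSum_eq_sum_stdAddChar {n : ℕ} (w : DualForm p n) :
    singularExpSum w = (p : ℂ) ^ (-(n + 1) : ℤ) *
      ∑ v : BinaryForm p n, singularIndicator v * ZMod.stdAddChar (w v) := by
  rw [singularExpSum, BinaryForm.card_eq, one_div, zpow_neg]
  congr 1
  · push_cast
    norm_cast
  · refine Finset.sum_congr rfl fun v _ => ?_
    rw [ZMod.stdAddChar_apply, ZMod.toCircle_apply]

open Finset in
open Classical in
theorem singularExpSum_eq_card (w : DualForm p 5) :
    singularExpSum w = (p : ℂ) ^ (-4 : ℤ) *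
      ((p : ℂ) ^ 2 * #{l : FormClass p 1 | w.KillsSq l.form} +
        #{q : FormClass p 2 | w.KillsSq q.form} -
        #{x : FormClass p 1 × FormClass p 1 | w.KillsSq (x.1.form * x.2.form)}) := by
  have hp : (p : ℂ) ≠ 0 := Nat.cast_ne_zero.mpr (Fact.out : p.Prime).ne_zero
  have hind : ∀ v : BinaryForm p 5, singularIndicator v =
      ∑ l : FormClass p 1,
        (if l.form ^ 2 ∣ (v : MvPolynomial (Fin 2) (ZMod p)) then (1 : ℂ) else 0) +
      ∑ q : FormClass p 2,
        (if q.form ^ 2 ∣ (v : MvPolynomial (Fin 2) (ZMod p)) then (1 : ℂ) else 0) -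
      ∑ x : FormClass p 1 × FormClass p 1,
        (if (x.1.form * x.2.form) ^ 2 ∣ (v : MvPolynomial (Fin 2) (ZMod p)) then (1 : ℂ) else 0)
      := by
    intro v
    have := congrArg (Int.cast : ℤ → ℂ) v.isSingular_eq_card
    push_cast at this
    rw [Finset.sum_boole, Finset.sum_boole, Finset.sum_boole, ← this]
    rfl
  have hmul : ∀ x : FormClass p 1 × FormClass p 1, (x.1.form * x.2.form).IsHomogeneous 2 :=
    fun x => x.1.form_isHomogeneous.mul x.2.form_isHomogeneous
  rw [singularExpSum_eq_sum_stdAddChar]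
  simp only [hind, sub_mul, add_mul, Finset.sum_mul, Finset.sum_sub_distrib,
    Finset.sum_add_distrib]
  rw [Finset.sum_comm, Finset.sum_comm (α := FormClass p 2),
    Finset.sum_comm (α := FormClass p 1 × FormClass p 1)]
  simp only [sum_sq_dvd_stdAddChar (j := 3) (k := 1) w (FormClass.form_ne_zero _)
      (FormClass.form_isHomogeneous _) rfl,
    sum_sq_dvd_stdAddChar (j := 1) (k := 2) w (FormClass.form_ne_zero _)
      (FormClass.form_isHomogeneous _) rfl,
    sum_sq_dvd_stdAddChar (j := 1) (k := 2) w
      (mul_ne_zero (FormClass.form_ne_zero _) (FormClass.form_ne_zero _)) (hmul _) rfl]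
  rw [← Finset.sum_filter, ← Finset.sum_filter, ← Finset.sum_filter]
  simp only [Finset.sum_const, nsmul_eq_mul]
  -- The subspaces have sizes p⁴ (linear) and p² (quadratic and pairs), against p⁶ forms in all.
  have e : (p : ℂ) ^ (-((5 : ℕ) + 1) : ℤ) = (p : ℂ) ^ (-4 : ℤ) * ((p : ℂ) ^ 2)⁻¹ := by
    rw [← zpow_natCast, ← zpow_neg, ← zpow_add₀ hp]
    norm_num
  rw [e]
  field_simp
  ring

end

/-! ### Pencils of conics in the projective plane. -/

namespace Matrix

theorem mul_mul_transpose_eq_dotProduct {R m n : Type*} [CommSemiring R] [Fintype n] (P : Matrix m n R)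
    (M : Matrix n n R) (i j : m) : (P * M * Pᵀ) i j = P i ⬝ᵥ M *ᵥ P j := by
  rw [Matrix.mul_assoc]
  rfl

/-- A quadratic form in three variables with a totally isotropic plane is degenerate. -/
theorem det_eq_zero_of_isotropic_plane {R : Type*} [CommRing R] [IsDomain R]
    {M : Matrix (Fin 3) (Fin 3) R} {r u v : Fin 3 → R} (hP : (Matrix.of ![r, u, v]).det ≠ 0)
    (huu : u ⬝ᵥ M *ᵥ u = 0) (huv : u ⬝ᵥ M *ᵥ v = 0) (hvu : v ⬝ᵥ M *ᵥ u = 0)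
    (hvv : v ⬝ᵥ M *ᵥ v = 0) : M.det = 0 := by
  set P := Matrix.of ![r, u, v] with hPdef
  -- The lower right 2 × 2 block vanishes, which kills a 3 × 3 determinant. Only `P.det ≠ 0` is
  -- needed, not invertibility, so this applies over the polynomial ring.
  have hdet : (P * M * Pᵀ).det = 0 := by
    have h11 : (P * M * Pᵀ) 1 1 = 0 := by rw [mul_mul_transpose_eq_dotProduct]; exact huu
    have h12 : (P * M * Pᵀ) 1 2 = 0 := by rw [mul_mul_transpose_eq_dotProduct]; exact huv
    have h21 : (P * M * Pᵀ) 2 1 = 0 := by rw [mul_mul_transpose_eq_dotProduct]; exact hvu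
    have h22 : (P * M * Pᵀ) 2 2 = 0 := by rw [mul_mul_transpose_eq_dotProduct]; exact hvv
    rw [Matrix.det_fin_three, h11, h12, h21, h22]
    ring
  rw [Matrix.det_mul, Matrix.det_mul, Matrix.det_transpose] at hdet
  simpa [hP] using hdet

open MvPolynomial

variable {F : Type*} [Field F]

/-- The pencil of two quadratic forms. -/
noncomputable def pencil (A B : Matrix (Fin 3) (Fin 3) F) :
    Matrix (Fin 3) (Fin 3) (MvPolynomial (Fin 2) F) :=
  (X 0 : MvPolynomial (Fin 2) F) • A.map C - (X 1 : MvPolynomial (Fin 2) F) • B.map C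

theorem pencil_mulVec (A B : Matrix (Fin 3) (Fin 3) F) (v : Fin 3 → F) :
    pencil A B *ᵥ (C ∘ v) = fun i => X 0 * C ((A *ᵥ v) i) - X 1 * C ((B *ᵥ v) i) := by
  rw [pencil, sub_mulVec, smul_mulVec, smul_mulVec]
  ext1 i
  rw [Pi.sub_apply, Pi.smul_apply, Pi.smul_apply, ← RingHom.map_mulVec, ← RingHom.map_mulVec]
  rfl

theorem dotProduct_pencil_mulVec (A B : Matrix (Fin 3) (Fin 3) F) (u v : Fin 3 → F) :
    (C ∘ u) ⬝ᵥ pencil A B *ᵥ (C ∘ v) = X 0 * C (u ⬝ᵥ A *ᵥ v) - X 1 * C (u ⬝ᵥ B *ᵥ v) := by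
  rw [pencil_mulVec]
  simp only [dotProduct, Fin.sum_univ_three, Function.comp_apply, C_add, C_mul]
  ring

variable {A B : Matrix (Fin 3) (Fin 3) F}

theorem det_pencil_eq_zero_of_mulVec {v : Fin 3 → F} (hv : v ≠ 0) (hA : A *ᵥ v = 0)
    (hB : B *ᵥ v = 0) : (pencil A B).det = 0 := by
  refine exists_mulVec_eq_zero_iff.mp ⟨C ∘ v, fun h => hv ?_, ?_⟩
  · ext i
    exact C_injective _ _ ((congrFun h i).trans C_0.symm)
  · rw [pencil_mulVec, hA, hB]
    ext1 i
    simp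

theorem det_pencil_eq_zero_of_isotropic_plane {u v : Fin 3 → F}
    (h : LinearIndependent F ![u, v])
    (hA : ∀ x ∈ ({u, v} : Set (Fin 3 → F)), ∀ y ∈ ({u, v} : Set (Fin 3 → F)), x ⬝ᵥ A *ᵥ y = 0)
    (hB : ∀ x ∈ ({u, v} : Set (Fin 3 → F)), ∀ y ∈ ({u, v} : Set (Fin 3 → F)), x ⬝ᵥ B *ᵥ y = 0) :
    (pencil A B).det = 0 := by
  -- A nonzero coordinate `i` of the cross product says that the `i`-th basis vector completes `u,
  -- v` to a basis.
  obtain ⟨i, hi⟩ := Function.ne_iff.mp (crossProduct_ne_zero_iff_linearIndependent.mpr h)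
  have key : ∀ x ∈ ({u, v} : Set (Fin 3 → F)), ∀ y ∈ ({u, v} : Set (Fin 3 → F)),
      (C ∘ x) ⬝ᵥ pencil A B *ᵥ (C ∘ y) = (0 : MvPolynomial (Fin 2) F) := by
    intro x hx y hy
    rw [dotProduct_pencil_mulVec, hA x hx y hy, hB x hx y hy]
    simp
  refine det_eq_zero_of_isotropic_plane (r := C ∘ Pi.single i 1) (u := C ∘ u) (v := C ∘ v) ?_
    (key u (by simp) u (by simp)) (key u (by simp) v (by simp)) (key v (by simp) u (by simp))
    (key v (by simp) v (by simp))
  have hdet : (Matrix.of ![Pi.single i 1, u, v]).det ≠ 0 := by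
    have := triple_product_eq_det (Pi.single i 1) u v
    rw [single_one_dotProduct] at this
    exact fun h0 => hi (this.trans h0)
  have hmap : (Matrix.of ![(C ∘ (Pi.single i 1 : Fin 3 → F) : Fin 3 → MvPolynomial (Fin 2) F),
      C ∘ u, C ∘ v]) = (Matrix.of ![Pi.single i 1, u, v]).map C := by
    ext1 a b
    fin_cases a <;> rfl
  rw [hmap, ← RingHom.mapMatrix_apply, ← RingHom.map_det]
  exact fun h0 => hdet (C_injective _ _ (h0.trans C_0.symm))

/-- Three distinct common zeros of a nondegenerate pencil of conics are not collinear. -/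
theorem det_ne_zero_of_isotropic (h2 : (2 : F) ≠ 0) (hAs : A.IsSymm) (hBs : B.IsSymm)
    (hdet : (pencil A B).det ≠ 0) {u v w : Fin 3 → F} (huv : LinearIndependent F ![u, v])
    (huw : LinearIndependent F ![u, w]) (hvw : LinearIndependent F ![v, w])
    (hA : ∀ x ∈ ({u, v, w} : Set (Fin 3 → F)), x ⬝ᵥ A *ᵥ x = 0)
    (hB : ∀ x ∈ ({u, v, w} : Set (Fin 3 → F)), x ⬝ᵥ B *ᵥ x = 0) :
    (Matrix.of ![u, v, w]).det ≠ 0 := by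
  intro h0
  obtain ⟨c, hc, hrel⟩ := exists_vecMul_eq_zero_iff.mpr h0
  rw [LinearIndependent.pair_iff] at huw hvw
  have huv' := LinearIndependent.pair_iff.mp huv
  have hrel' : c 0 • u + c 1 • v + c 2 • w = 0 := by
    rw [← hrel]
    ext i
    simp [vecMul, dotProduct, Fin.sum_univ_three]
  have hc0 : c 0 ≠ 0 := by
    intro h
    have h12 := hvw (c 1) (c 2) (by simpa [h] using hrel')
    exact hc (by ext i; fin_cases i; exacts [h, h12.1, h12.2])
  have hc1 : c 1 ≠ 0 := by
    intro h
    have h12 := huw (c 0) (c 2) (by simpa [h] using hrel')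
    exact hc (by ext i; fin_cases i; exacts [h12.1, h, h12.2])
  -- A dependence among the three points makes `c 0 • u + c 1 • v` a multiple of `w`, hence
  -- isotropic; expanding leaves only the cross term, whose coefficient `2 * c 0 * c 1` is nonzero.
  -- So the whole plane of `u, v` is isotropic.
  have polar : ∀ D : Matrix (Fin 3) (Fin 3) F, D.IsSymm →
      (∀ x ∈ ({u, v, w} : Set (Fin 3 → F)), x ⬝ᵥ D *ᵥ x = 0) → u ⬝ᵥ D *ᵥ v = 0 ∧
        v ⬝ᵥ D *ᵥ u = 0 := by
    intro D hD hx
    have hsymm : v ⬝ᵥ D *ᵥ u = u ⬝ᵥ D *ᵥ v := by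
      rw [dotProduct_mulVec, dotProduct_comm, ← mulVec_transpose, hD.eq]
    have hw : c 0 • u + c 1 • v = -(c 2 • w) := eq_neg_of_add_eq_zero_left hrel'
    have hq : (c 0 • u + c 1 • v) ⬝ᵥ D *ᵥ (c 0 • u + c 1 • v) = 0 := by
      rw [hw]
      simp [mulVec_neg, mulVec_smul, hx w (by simp)]
    simp only [mulVec_add, mulVec_smul, add_dotProduct, dotProduct_add, smul_dotProduct,
      dotProduct_smul, hx u (by simp), hx v (by simp), hsymm, smul_eq_mul] at hq
    have : 2 * (c 0 * c 1) * (u ⬝ᵥ D *ᵥ v) = 0 := by linear_combination hq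
    have huv0 := (mul_eq_zero.mp this).resolve_left (mul_ne_zero h2 (mul_ne_zero hc0 hc1))
    exact ⟨huv0, hsymm.trans huv0⟩
  have plane : ∀ D : Matrix (Fin 3) (Fin 3) F, D.IsSymm →
      (∀ x ∈ ({u, v, w} : Set (Fin 3 → F)), x ⬝ᵥ D *ᵥ x = 0) →
      ∀ x ∈ ({u, v} : Set (Fin 3 → F)), ∀ y ∈ ({u, v} : Set (Fin 3 → F)),
        x ⬝ᵥ D *ᵥ y = 0 := by
    rintro D hD hx x (rfl | rfl) y (rfl | rfl)
    exacts [hx _ (by simp), (polar D hD hx).1, (polar D hD hx).2, hx _ (by simp)]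
  exact hdet (det_pencil_eq_zero_of_isotropic_plane huv (plane A hAs hA) (plane B hBs hB))

/-- Two conics through five points in general position are proportional. -/
theorem exists_smul_eq_smul_of_isotropic (h2 : (2 : F) ≠ 0) (hAs : A.IsSymm) (hBs : B.IsSymm)
    {x : Fin 5 → Fin 3 → F}
    (hx : ∀ i j k, i ≠ j → i ≠ k → j ≠ k → (Matrix.of ![x i, x j, x k]).det ≠ 0)
    (hA : ∀ i, x i ⬝ᵥ A *ᵥ x i = 0) (hB : ∀ i, x i ⬝ᵥ B *ᵥ x i = 0) :
    ∃ s t : F, (s ≠ 0 ∨ t ≠ 0) ∧ s • A = t • B := by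
  set P := Matrix.of ![x 0, x 1, x 2] with hPdef
  have hPdet : P.det ≠ 0 := hx 0 1 2 (by decide) (by decide) (by decide)
  have hPunit : IsUnit P.det := isUnit_iff_ne_zero.mpr hPdet
  have coords : ∀ y : Fin 3 → F, ∃ c : Fin 3 → F, y = c 0 • x 0 + c 1 • x 1 + c 2 • x 2 := by
    intro y
    refine ⟨y ᵥ* P⁻¹, ?_⟩
    have : (y ᵥ* P⁻¹) ᵥ* P = y := by
      rw [vecMul_vecMul, nonsing_inv_mul P hPunit, vecMul_one]
    conv_lhs => rw [← this]
    ext i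
    simp [hPdef, vecMul, dotProduct, Fin.sum_univ_three]
  obtain ⟨u, hu⟩ := coords (x 3)
  obtain ⟨v, hv⟩ := coords (x 4)
  have hu0 : u 0 ≠ 0 := by
    intro h
    refine hx 3 1 2 (by decide) (by decide) (by decide) ?_
    rw [hu, h, det_fin_three]
    simp
    ring
  have hv0 : v 0 ≠ 0 := by
    intro h
    refine hx 4 1 2 (by decide) (by decide) (by decide) ?_
    rw [hv, h, det_fin_three]
    simp
    ring
  have huv : u 2 * v 1 - u 1 * v 2 ≠ 0 := by
    intro h
    refine hx 0 3 4 (by decide) (by decide) (by decide) ?_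
    have : (Matrix.of ![x 0, x 3, x 4]).det = -(u 2 * v 1 - u 1 * v 2) * P.det := by
      rw [hu, hv, det_fin_three, hPdef, det_fin_three]
      simp
      ring
    rw [this, h]
    ring
  set N := u 0 * v 0 * (u 2 * v 1 - u 1 * v 2) with hN
  have hN0 : N ≠ 0 := mul_ne_zero (mul_ne_zero hu0 hv0) huv
  -- In the basis `x 0, x 1, x 2` the form has zero diagonal, so three unknowns remain. The points
  -- `x 3`, `x 4` give two linear equations, and eliminating one unknown at a time expresses the
  -- (0,2) and (0,1) entries through the (1,2) entry, with common denominator `N`.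
  have rel : ∀ D : Matrix (Fin 3) (Fin 3) F, D.IsSymm → (∀ i, x i ⬝ᵥ D *ᵥ x i = 0) →
      (x 1 ⬝ᵥ D *ᵥ x 0 = x 0 ⬝ᵥ D *ᵥ x 1 ∧ x 2 ⬝ᵥ D *ᵥ x 0 = x 0 ⬝ᵥ D *ᵥ x 2 ∧
        x 2 ⬝ᵥ D *ᵥ x 1 = x 1 ⬝ᵥ D *ᵥ x 2) ∧
      N * (x 0 ⬝ᵥ D *ᵥ x 2) = u 1 * v 1 * (u 0 * v 2 - u 2 * v 0) * (x 1 ⬝ᵥ D *ᵥ x 2) ∧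
      N * (x 0 ⬝ᵥ D *ᵥ x 1) = u 2 * v 2 * (u 1 * v 0 - u 0 * v 1) * (x 1 ⬝ᵥ D *ᵥ x 2) := by
    intro D hD hiso
    have hsymm : ∀ y z : Fin 3 → F, y ⬝ᵥ D *ᵥ z = z ⬝ᵥ D *ᵥ y := by
      intro y z
      rw [dotProduct_mulVec, dotProduct_comm, ← mulVec_transpose, hD.eq]
    have expand : ∀ c : Fin 3 → F, (c 0 • x 0 + c 1 • x 1 + c 2 • x 2) ⬝ᵥ
        D *ᵥ (c 0 • x 0 + c 1 • x 1 + c 2 • x 2) = 0 →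
        c 1 * c 2 * (x 1 ⬝ᵥ D *ᵥ x 2) + c 0 * c 2 * (x 0 ⬝ᵥ D *ᵥ x 2) +
          c 0 * c 1 * (x 0 ⬝ᵥ D *ᵥ x 1) = 0 := by
      intro c hc
      simp only [mulVec_add, mulVec_smul, add_dotProduct, dotProduct_add, smul_dotProduct,
        dotProduct_smul, hiso 0, hiso 1, hiso 2, hsymm (x 1) (x 0), hsymm (x 2) (x 0),
        hsymm (x 2) (x 1), smul_eq_mul] at hc
      refine (mul_eq_zero.mp ?_).resolve_left h2
      linear_combination hc
    have e3 := expand u (hu ▸ hiso 3)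
    have e4 := expand v (hv ▸ hiso 4)
    refine ⟨⟨hsymm _ _, hsymm _ _, hsymm _ _⟩, ?_, ?_⟩
    · rw [hN]; linear_combination (v 0 * v 1) * e3 - (u 0 * u 1) * e4
    · rw [hN]; linear_combination (-(v 0 * v 2)) * e3 + (u 0 * u 2) * e4
  obtain ⟨⟨a10, a20, a21⟩, a02, a01⟩ := rel A hAs hA
  obtain ⟨⟨b10, b20, b21⟩, b02, b01⟩ := rel B hBs hB
  have conclude : ∀ s t : F, s * (x 1 ⬝ᵥ A *ᵥ x 2) = t * (x 1 ⬝ᵥ B *ᵥ x 2) →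
      s • A = t • B := by
    intro s t h12
    have h02 : s * (x 0 ⬝ᵥ A *ᵥ x 2) = t * (x 0 ⬝ᵥ B *ᵥ x 2) :=
      mul_left_cancel₀ hN0 (by
        linear_combination s * a02 - t * b02 + u 1 * v 1 * (u 0 * v 2 - u 2 * v 0) * h12)
    have h01 : s * (x 0 ⬝ᵥ A *ᵥ x 1) = t * (x 0 ⬝ᵥ B *ᵥ x 1) :=
      mul_left_cancel₀ hN0 (by
        linear_combination s * a01 - t * b01 + u 2 * v 2 * (u 1 * v 0 - u 0 * v 1) * h12)
    have hconj : P * (s • A) * Pᵀ = P * (t • B) * Pᵀ := by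
      ext i j
      rw [mul_mul_transpose_eq_dotProduct, mul_mul_transpose_eq_dotProduct, smul_mulVec, smul_mulVec, dotProduct_smul, dotProduct_smul,
        smul_eq_mul, smul_eq_mul]
      have hd : ∀ i, s * (x i ⬝ᵥ A *ᵥ x i) = t * (x i ⬝ᵥ B *ᵥ x i) := fun i => by
        rw [hA, hB, mul_zero, mul_zero]
      have h10 : s * (x 1 ⬝ᵥ A *ᵥ x 0) = t * (x 1 ⬝ᵥ B *ᵥ x 0) := by rw [a10, b10, h01]
      have h20 : s * (x 2 ⬝ᵥ A *ᵥ x 0) = t * (x 2 ⬝ᵥ B *ᵥ x 0) := by rw [a20, b20, h02]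
      have h21 : s * (x 2 ⬝ᵥ A *ᵥ x 1) = t * (x 2 ⬝ᵥ B *ᵥ x 1) := by rw [a21, b21, h12]
      fin_cases i <;> fin_cases j
      exacts [hd 0, h01, h02, h10, hd 1, h12, h20, h21, hd 2]
    have hPt : IsUnit Pᵀ := (isUnit_iff_isUnit_det _).mpr (by rwa [det_transpose])
    exact ((isUnit_iff_isUnit_det _).mpr hPunit).mul_left_cancel (hPt.mul_right_cancel hconj)
  by_cases h0 : x 1 ⬝ᵥ A *ᵥ x 2 = 0
  · exact ⟨1, 0, Or.inl one_ne_zero, conclude 1 0 (by rw [h0]; ring)⟩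
  · exact ⟨x 1 ⬝ᵥ B *ᵥ x 2, x 1 ⬝ᵥ A *ᵥ x 2, Or.inr h0, conclude _ _ (by ring)⟩

end Matrix

/-! ### Killed classes and the Hankel matrices. -/

section

open MvPolynomial

variable {p : ℕ}

theorem MvPolynomial.dvd_of_dvd_of_totalDegree_eq {σ F : Type*} [Field F] {a b : MvPolynomial σ F}
    (hb : b ≠ 0) (h : a ∣ b) (hdeg : a.totalDegree = b.totalDegree) : b ∣ a := by
  obtain ⟨c, rfl⟩ := h
  have ha := left_ne_zero_of_mul hb
  have hc := right_ne_zero_of_mul hb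
  rw [totalDegree_mul_of_isDomain ha hc] at hdeg
  refine (IsUnit.mul_right_dvd ?_).mpr dvd_rfl
  have hC := totalDegree_eq_zero_iff_eq_C.mp (show c.totalDegree = 0 by omega)
  rw [hC] at hc ⊢
  exact (isUnit_iff_ne_zero.mpr fun h => hc (by rw [h, C_0])).map C

theorem DualForm.KillsSq.of_dvd {n : ℕ} {w : DualForm p n} {d e : MvPolynomial (Fin 2) (ZMod p)}
    (hw : w.KillsSq d) (h : d ∣ e) : w.KillsSq e :=
  fun v hv => hw v ((pow_dvd_pow_of_dvd h 2).trans hv)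

variable [Fact p.Prime]

namespace FormClass

theorem prime_form (l : FormClass p 1) : Prime l.form := by
  refine (irreducible_of_totalDegree_eq_one l.totalDegree_form fun x hx => ?_).prime
  refine isUnit_iff_ne_zero.mpr ?_
  rintro rfl
  exact l.form_ne_zero (MvPolynomial.ext _ _ fun i => by simpa using hx i)

theorem eq_of_form_dvd {n : ℕ} {l m : FormClass p n} (h : l.form ∣ m.form) : l = m := by
  rw [← m.mk_rep]
  exact (l.form_dvd_iff m.rep_nonzero).mp h

open Finset

open Classical in
theorem card_linear_dvd_quadratic_le {d : MvPolynomial (Fin 2) (ZMod p)} (hd : d.IsHomogeneous 2)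
    (h0 : d ≠ 0) : #{l : FormClass p 1 | l.form ∣ d} ≤ 2 := by
  rcases ({l : FormClass p 1 | l.form ∣ d} : Finset (FormClass p 1)).eq_empty_or_nonempty
    with he | ⟨l, hl⟩
  · simp [he]
  · have hpair : 0 < #{x : FormClass p 1 × FormClass p 1 | x.1.form * x.2.form ∣ d} := by
      rw [card_pairs_dvd_quadratic hd h0]
      exact card_pos.mpr ⟨l, hl⟩
    obtain ⟨⟨a, b⟩, hab⟩ := card_pos.mp hpair
    simp only [mem_filter, mem_univ, true_and] at hab
    have hdvd : d ∣ a.form * b.form := by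
      refine dvd_of_dvd_of_totalDegree_eq h0 hab ?_
      rw [totalDegree_mul_of_isDomain a.form_ne_zero b.form_ne_zero, totalDegree_form,
        totalDegree_form, hd.totalDegree h0]
    refine (card_le_card (t := {a, b}) fun m hm => ?_).trans card_le_two
    simp only [mem_filter, mem_univ, true_and] at hm
    rw [mem_insert, mem_singleton]
    exact (m.prime_form.dvd_or_dvd (hm.trans hdvd)).imp eq_of_form_dvd eq_of_form_dvd

-- Pairs are grouped by the class of their product; the fibre over `q` has as many elements as `q`
-- has linear divisors.
open Classical in
theorem card_pairs_killsSq (w : DualForm p 5) :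
    #{x : FormClass p 1 × FormClass p 1 | w.KillsSq (x.1.form * x.2.form)} =
      ∑ q : FormClass p 2 with w.KillsSq q.form, #{l : FormClass p 1 | l.form ∣ q.form} := by
  have hne : ∀ x : FormClass p 1 × FormClass p 1, x.1.form * x.2.form ≠ 0 :=
    fun x => mul_ne_zero x.1.form_ne_zero x.2.form_ne_zero
  have hhom : ∀ x : FormClass p 1 × FormClass p 1, (x.1.form * x.2.form).IsHomogeneous 2 :=
    fun x => x.1.form_isHomogeneous.mul x.2.form_isHomogeneous
  choose f hf using fun x => exists_form_dvd_iff (hhom x) (hne x)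
  have hdvd : ∀ x q, x.1.form * x.2.form ∣ q.form ↔ f x = q := by
    intro x q
    rw [eq_comm, ← hf x q]
    have hdeg : (x.1.form * x.2.form).totalDegree = q.form.totalDegree := by
      rw [(hhom x).totalDegree (hne x), totalDegree_form]
    exact ⟨fun h => dvd_of_dvd_of_totalDegree_eq q.form_ne_zero h hdeg,
      fun h => dvd_of_dvd_of_totalDegree_eq (hne x) h hdeg.symm⟩
  rw [card_eq_sum_card_fiberwise (f := f) (t := ({q | w.KillsSq q.form} : Finset (FormClass p 2)))]
  · refine sum_congr rfl fun q hq => ?_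
    rw [← card_pairs_dvd_quadratic q.form_isHomogeneous q.form_ne_zero, filter_filter]
    congr 1
    ext x
    simp only [mem_filter, mem_univ, true_and] at hq ⊢
    rw [hdvd]
    refine ⟨fun h => h.2, fun h => ⟨hq.of_dvd ?_, h⟩⟩
    exact ((hf x q).mpr h.symm)
  · intro x hx
    simp only [coe_filter, mem_univ, true_and, Set.mem_ofPred_eq] at hx ⊢
    exact hx.of_dvd ((hdvd x _).mpr rfl)

open Classical in
theorem abs_card_sub_card_le (w : DualForm p 5) :
    |(#{q : FormClass p 2 | w.KillsSq q.form} -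
      #{x : FormClass p 1 × FormClass p 1 | w.KillsSq (x.1.form * x.2.form)} : ℤ)| ≤
      #{q : FormClass p 2 | w.KillsSq q.form ∧ #{l : FormClass p 1 | l.form ∣ q.form} ≠ 1} := by
  rw [card_pairs_killsSq, card_eq_sum_ones]
  push_cast
  rw [← sum_sub_distrib]
  refine (abs_sum_le_sum_abs _ _).trans ?_
  rw [← filter_filter, ← sum_boole]
  refine sum_le_sum fun q _ => ?_
  have := card_linear_dvd_quadratic_le q.form_isHomogeneous q.form_ne_zero
  split_ifs with h <;> rw [abs_le] <;> omega

/-- The coordinates of a representative of a class of forms. -/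
noncomputable def coords {n : ℕ} (q : FormClass p n) : Fin (n + 1) → ZMod p :=
  BinaryForm.coordEquiv p n q.rep

theorem coords_ne_zero {n : ℕ} (q : FormClass p n) : q.coords ≠ 0 :=
  (BinaryForm.coordEquiv p n).map_ne_zero_iff.mpr q.rep_nonzero

theorem coords_injective {n : ℕ} : Function.Injective (coords : FormClass p n → _) := by
  intro q r h
  have := (BinaryForm.coordEquiv p n).injective h
  rw [← q.mk_rep, ← r.mk_rep]
  congr

theorem form_eq_sum {n : ℕ} (q : FormClass p n) :
    q.form = ∑ j : Fin (n + 1), C (q.coords j) * (X 0 ^ (n - (j : ℕ)) * X 1 ^ (j : ℕ)) := by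
  have := congrArg Subtype.val (BinaryForm.eq_sum_coordEquiv n q.rep)
  rw [Submodule.coe_sum] at this
  refine this.trans (sum_congr rfl fun j _ => ?_)
  rw [Submodule.coe_smul, smul_eq_C_mul]
  rfl

theorem form_eq_linear (l : FormClass p 1) :
    l.form = C (l.coords 0) * X 0 + C (l.coords 1) * X 1 := by
  rw [form_eq_sum, Fin.sum_univ_two]
  simp

theorem form_eq_quadratic (q : FormClass p 2) :
    q.form = C (q.coords 0) * X 0 ^ 2 + C (q.coords 1) * (X 0 * X 1) +
      C (q.coords 2) * X 1 ^ 2 := by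
  rw [form_eq_sum, Fin.sum_univ_three]
  simp

end FormClass

namespace DualForm

theorem eq_zero_of_coord {n : ℕ} {w : DualForm p n} (h : ∀ j, w.coord j = 0) : w = 0 := by
  ext v
  rw [BinaryForm.eq_sum_coordEquiv n v, map_sum]
  simp only [map_smul, LinearMap.zero_apply]
  exact Finset.sum_eq_zero fun j _ => by rw [show w (BinaryForm.stdMonomial p n j) = 0 from h j,
    smul_zero]

theorem apply_sum_stdMonomial {n : ℕ} (w : DualForm p n) (c : Fin (n + 1) → ZMod p) :
    w (∑ j, c j • BinaryForm.stdMonomial p n j) = ∑ j, c j * w.coord j := by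
  rw [map_sum]
  simp only [map_smul, smul_eq_mul]
  rfl

theorem KillsSq.sum_eq_zero {w : DualForm p 5} {d : MvPolynomial (Fin 2) (ZMod p)}
    (hw : w.KillsSq d) (c : Fin 6 → ZMod p)
    (hc : d ^ 2 ∣ C (c 0) * X 0 ^ 5 + C (c 1) * (X 0 ^ 4 * X 1) + C (c 2) * (X 0 ^ 3 * X 1 ^ 2) +
      C (c 3) * (X 0 ^ 2 * X 1 ^ 3) + C (c 4) * (X 0 * X 1 ^ 4) + C (c 5) * X 1 ^ 5) :
    c 0 * w.coord 0 + c 1 * w.coord 1 + c 2 * w.coord 2 + c 3 * w.coord 3 + c 4 * w.coord 4 +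
      c 5 * w.coord 5 = 0 := by
  have h := hw (∑ j, c j • BinaryForm.stdMonomial p 5 j) ?_
  · rwa [apply_sum_stdMonomial, Fin.sum_univ_six] at h
  · convert hc using 1
    rw [Submodule.coe_sum, Fin.sum_univ_six]
    simp [smul_eq_C_mul]

/-- The kernel vector is the coefficient vector of `l.form ^ 2`: its products with the four cubic
monomials give the four recurrences that make up the rows of both matrices. -/
theorem exists_mulVec_catMatrix_eq_zero_of_killsSq {w : DualForm p 5} {l : FormClass p 1} (h : w.KillsSq l.form) :
    ∃ v : Fin 3 → ZMod p, v ≠ 0 ∧ Matrix.mulVec (w.catMatrix 2 2 0 (by omega)) v = 0 ∧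
      Matrix.mulVec (w.catMatrix 2 2 1 (by omega)) v = 0 := by
  set a := l.coords 0 with ha
  set b := l.coords 1 with hb
  have hl : l.form = C a * X 0 + C b * X 1 := l.form_eq_linear
  have two : (C 2 : MvPolynomial (Fin 2) (ZMod p)) = 2 := map_ofNat C 2
  have e0 := h.sum_eq_zero ![a ^ 2, 2 * a * b, b ^ 2, 0, 0, 0] ⟨X 0 ^ 3, by simp [hl, two]; ring⟩
  have e1 := h.sum_eq_zero ![0, a ^ 2, 2 * a * b, b ^ 2, 0, 0] ⟨X 0 ^ 2 * X 1, by simp [hl, two]; ring⟩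
  have e2 := h.sum_eq_zero ![0, 0, a ^ 2, 2 * a * b, b ^ 2, 0] ⟨X 0 * X 1 ^ 2, by simp [hl, two]; ring⟩
  have e3 := h.sum_eq_zero ![0, 0, 0, a ^ 2, 2 * a * b, b ^ 2] ⟨X 1 ^ 3, by simp [hl, two]; ring⟩
  simp at e0 e1 e2 e3
  refine ⟨![a ^ 2, 2 * a * b, b ^ 2], fun hv => l.coords_ne_zero ?_, ?_, ?_⟩
  · have h0 : a ^ 2 = 0 := congrFun hv 0
    have h2 : b ^ 2 = 0 := congrFun hv 2
    ext i
    fin_cases i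
    exacts [pow_eq_zero_iff two_ne_zero |>.mp h0, pow_eq_zero_iff two_ne_zero |>.mp h2]
  · ext i
    fin_cases i <;> simp [Matrix.mulVec, dotProduct, Fin.sum_univ_three, catMatrix]
    · linear_combination e0
    · linear_combination e1
    · linear_combination e2
  · ext i
    fin_cases i <;> simp [Matrix.mulVec, dotProduct, Fin.sum_univ_three, catMatrix]
    · linear_combination e1
    · linear_combination e2
    · linear_combination e3

/-- Pairing `w` with `q.form ^ 2 * X 0` and `q.form ^ 2 * X 1` evaluates the two Hankel quadratic
forms at the coefficients of `q`. -/
theorem KillsSq.quadratic {w : DualForm p 5} {q : FormClass p 2} (h : w.KillsSq q.form) :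
    q.coords ⬝ᵥ Matrix.mulVec (w.catMatrix 2 2 0 (by omega)) q.coords = 0 ∧
      q.coords ⬝ᵥ Matrix.mulVec (w.catMatrix 2 2 1 (by omega)) q.coords = 0 := by
  set a := q.coords 0 with ha
  set b := q.coords 1 with hb
  set c := q.coords 2 with hc
  have hq : q.form = C a * X 0 ^ 2 + C b * (X 0 * X 1) + C c * X 1 ^ 2 := q.form_eq_quadratic
  have two : (C 2 : MvPolynomial (Fin 2) (ZMod p)) = 2 := map_ofNat C 2
  have e0 := h.sum_eq_zero ![a ^ 2, 2 * a * b, 2 * a * c + b ^ 2, 2 * b * c, c ^ 2, 0]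
    ⟨X 0, by simp [hq, two]; ring⟩
  have e1 := h.sum_eq_zero ![0, a ^ 2, 2 * a * b, 2 * a * c + b ^ 2, 2 * b * c, c ^ 2]
    ⟨X 1, by simp [hq, two]; ring⟩
  simp at e0 e1
  constructor <;> simp [Matrix.mulVec, dotProduct, Fin.sum_univ_three, catMatrix, ← ha, ← hb, ← hc]
  · linear_combination e0
  · linear_combination e1

end DualForm

end

/-! ### Bounds on killed quadratic classes. -/

section

open MvPolynomial Finset

variable {p : ℕ}

namespace DualForm

theorem catMatrix_isSymm {n : ℕ} (w : DualForm p n) (s r : ℕ) (h : r + s + s ≤ n) :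
    (w.catMatrix s s r h).IsSymm := by
  ext i j
  simp only [catMatrix, Matrix.transpose_apply, Matrix.of_apply]
  congr 2
  omega

variable [Fact p.Prime]

theorem det_pencil_catMatrix_ne_zero {w : DualForm p 5} (hcat : catCovariant 2 w ≠ 0) :
    (Matrix.pencil (w.catMatrix 2 2 1 (by omega)) (w.catMatrix 2 2 0 (by omega))).det ≠ 0 :=
  hcat

/-- The two Hankel matrices of a functional with nonzero catalecticant covariant are not
proportional. -/
theorem catMatrix_not_proportional {w : DualForm p 5} (hcat : catCovariant 2 w ≠ 0)
    {s t : ZMod p} (hst : s ≠ 0 ∨ t ≠ 0) :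
    s • w.catMatrix 2 2 1 (by omega) ≠ t • w.catMatrix 2 2 0 (by omega) := by
  intro h
  have e : ∀ i j : Fin 3, s * w.catMatrix 2 2 1 (by omega) i j =
      t * w.catMatrix 2 2 0 (by omega) i j := fun i j => congrFun (congrFun h i) j
  have e0 : s * w.coord 1 = t * w.coord 0 := e 0 0
  have e1 : s * w.coord 2 = t * w.coord 1 := e 0 1
  have e2 : s * w.coord 3 = t * w.coord 2 := e 0 2
  have e3 : s * w.coord 4 = t * w.coord 3 := e 1 2
  have e4 : s * w.coord 5 = t * w.coord 4 := e 2 2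
  refine det_pencil_catMatrix_ne_zero hcat ?_
  by_cases hs : s = 0
  · have ht : t ≠ 0 := hst.resolve_left (not_not.mpr hs)
    simp only [hs, zero_mul, zero_eq_mul, ht, false_or] at e0 e1 e2 e3 e4
    refine Matrix.det_pencil_eq_zero_of_mulVec (v := ![1, 0, 0]) (fun hv => ?_) ?_ ?_
    · exact one_ne_zero (congrFun hv 0)
    all_goals
      ext i
      fin_cases i <;> simp [Matrix.mulVec, dotProduct, Fin.sum_univ_three, catMatrix,
        e0, e1, e2, e3, e4]
  -- Proportional Hankel matrices mean `s * a_{j+1} = t * a_j` for all `j`, so each row is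
  -- orthogonal to `![t, -s, 0]`.
  · refine Matrix.det_pencil_eq_zero_of_mulVec (v := ![t, -s, 0]) (fun hv => ?_) ?_ ?_
    · exact hs (neg_eq_zero.mp (congrFun hv 1))
    all_goals
      ext i
      fin_cases i <;> simp [Matrix.mulVec, dotProduct, Fin.sum_univ_three, catMatrix]
    · linear_combination -e1
    · linear_combination -e2
    · linear_combination -e3
    · linear_combination -e0
    · linear_combination -e1
    · linear_combination -e2

theorem not_killsSq_linear {w : DualForm p 5} (hcat : catCovariant 2 w ≠ 0) (l : FormClass p 1) :
    ¬ w.KillsSq l.form := by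
  intro h
  obtain ⟨v, hv, h0, h1⟩ := exists_mulVec_catMatrix_eq_zero_of_killsSq h
  exact det_pencil_catMatrix_ne_zero hcat (Matrix.det_pencil_eq_zero_of_mulVec hv h1 h0)

theorem linearIndependent_coords {n : ℕ} {q r : FormClass p n} (h : q ≠ r) :
    LinearIndependent (ZMod p) ![q.coords, r.coords] := by
  have hl := Projectivization.linearIndependent_pair_iff_ne.mpr h
  rw [LinearIndependent.pair_iff] at hl ⊢
  intro s t hst
  refine hl s t ((BinaryForm.coordEquiv p n).injective ?_)
  rw [map_add, map_smul, map_smul, map_zero]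
  exact hst

open Classical in
/-- In odd characteristic, at most four classes of quadratic forms have their square multiples
killed by a functional with nonzero catalecticant covariant. -/
theorem card_killsSq_quadratic_le (hp : p ≠ 2) {w : DualForm p 5}
    (hcat : catCovariant 2 w ≠ 0) : #{q : FormClass p 2 | w.KillsSq q.form} ≤ 4 := by
  by_contra hcard
  have h5 : Fintype.card (Fin 5) ≤
      Fintype.card ({q | w.KillsSq q.form} : Finset (FormClass p 2)) := by
    rw [Fintype.card_fin, Fintype.card_coe]
    omega
  obtain ⟨f⟩ := Function.Embedding.nonempty_of_card_le h5
  have hf : ∀ i, w.KillsSq (f i).1.form := fun i => (mem_filter.mp (f i).2).2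
  have hne : ∀ i j, i ≠ j → (f i).1 ≠ (f j).1 :=
    fun i j hij h => hij (f.injective (Subtype.ext h))
  have h2 : (2 : ZMod p) ≠ 0 := by
    have := ZMod.prime_ne_zero p 2 hp
    exact_mod_cast this
  have hA := w.catMatrix_isSymm 2 1 (by omega)
  have hB := w.catMatrix_isSymm 2 0 (by omega)
  have h1 : ∀ i, (f i).1.coords ⬝ᵥ
      Matrix.mulVec (w.catMatrix 2 2 1 (by omega)) (f i).1.coords = 0 := fun i => (hf i).quadratic.2
  have h0 : ∀ i, (f i).1.coords ⬝ᵥ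
      Matrix.mulVec (w.catMatrix 2 2 0 (by omega)) (f i).1.coords = 0 := fun i => (hf i).quadratic.1
  obtain ⟨s, t, hst, h⟩ := Matrix.exists_smul_eq_smul_of_isotropic h2 hA hB
    (x := fun i => (f i).1.coords)
    (fun i j k hij hik hjk => Matrix.det_ne_zero_of_isotropic h2 hA hB
      (det_pencil_catMatrix_ne_zero hcat) (linearIndependent_coords (hne i j hij))
      (linearIndependent_coords (hne i k hik)) (linearIndependent_coords (hne j k hjk))
      (by rintro x (rfl | rfl | rfl) <;> exact h1 _)
      (by rintro x (rfl | rfl | rfl) <;> exact h0 _)) h1 h0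
  exact catMatrix_not_proportional hcat hst h

end DualForm

theorem ZMod.card_plane_inter_ne_zero_le :
    ∀ a b c : ZMod 2, (a ≠ 0 ∨ b ≠ 0 ∨ c ≠ 0) →
      #{x : Fin 3 → ZMod 2 | x 1 ≠ 0 ∧ a * x 0 + b * x 1 + c * x 2 = 0} ≤ 2 := by
  decide

/-- Over F₂ a quadratic form without the mixed term is the square of a linear form, by Frobenius. -/
theorem FormClass.card_linear_dvd_eq_one_of_coords_one_eq_zero [Fact (Nat.Prime 2)]
    {q : FormClass 2 2} [DecidablePred fun l : FormClass 2 1 => l.form ∣ q.form]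
    (h : q.coords 1 = 0) : #{l : FormClass 2 1 | l.form ∣ q.form} = 1 := by
  have hsq : ∀ a : ZMod 2, a ^ 2 = a := fun a => ZMod.pow_card a
  have hq : q.form = (C (q.coords 0) * X 0 + C (q.coords 2) * X 1) ^ 2 := by
    have two : (2 : MvPolynomial (Fin 2) (ZMod 2)) = 0 := CharTwo.two_eq_zero
    rw [q.form_eq_quadratic, h, add_sq, mul_pow, mul_pow, ← C_pow, ← C_pow, hsq, hsq, two, C_0]
    ring
  have h0 : C (q.coords 0) * X 0 + C (q.coords 2) * X 1 ≠ (0 : MvPolynomial (Fin 2) (ZMod 2)) :=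
    fun h0 => q.form_ne_zero (by rw [hq, h0]; ring)
  have hhom : (C (q.coords 0) * X 0 + C (q.coords 2) * X 1 :
      MvPolynomial (Fin 2) (ZMod 2)).IsHomogeneous 1 :=
    (isHomogeneous_C_mul_X _ _).add (isHomogeneous_C_mul_X _ _)
  obtain ⟨D, hD⟩ := exists_form_dvd_iff hhom h0
  refine card_eq_one.mpr ⟨D, ?_⟩
  ext l
  rw [mem_filter, mem_singleton, ← hD, hq]
  exact ⟨fun hl => l.prime_form.dvd_of_dvd_pow hl.2, fun hl => ⟨mem_univ _, hl.trans ⟨_, sq _⟩⟩⟩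

open Classical in
theorem DualForm.card_killsSq_quadratic_two_le [Fact (Nat.Prime 2)] {w : DualForm 2 5}
    (hw : w ≠ 0) :
    #{q : FormClass 2 2 | w.KillsSq q.form ∧ #{l : FormClass 2 1 | l.form ∣ q.form} ≠ 1} ≤ 2 := by
  have hsq : ∀ a : ZMod 2, a * a = a := fun a => by rw [← sq, ZMod.pow_card]
  have h2 : (2 : ZMod 2) = 0 := rfl
  -- Over F₂ the off-diagonal terms of a symmetric form cancel in pairs and `a ^ 2 = a`, so each
  -- conic reduces to the linear form given by its diagonal.
  have plane : ∀ q : FormClass 2 2, w.KillsSq q.form →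
      w.coord 0 * q.coords 0 + w.coord 2 * q.coords 1 + w.coord 4 * q.coords 2 = 0 ∧
      w.coord 1 * q.coords 0 + w.coord 3 * q.coords 1 + w.coord 5 * q.coords 2 = 0 := by
    intro q hq
    obtain ⟨e0, e1⟩ := hq.quadratic
    simp [Matrix.mulVec, dotProduct, Fin.sum_univ_three, catMatrix] at e0 e1
    constructor
    · linear_combination e0 - w.coord 0 * hsq (q.coords 0) - w.coord 2 * hsq (q.coords 1) -
        w.coord 4 * hsq (q.coords 2) - (q.coords 0 * q.coords 1 * w.coord 1 +
        q.coords 0 * q.coords 2 * w.coord 2 + q.coords 1 * q.coords 2 * w.coord 3) * h2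
    · linear_combination e1 - w.coord 1 * hsq (q.coords 0) - w.coord 3 * hsq (q.coords 1) -
        w.coord 5 * hsq (q.coords 2) - (q.coords 0 * q.coords 1 * w.coord 2 +
        q.coords 0 * q.coords 2 * w.coord 3 + q.coords 1 * q.coords 2 * w.coord 4) * h2
  have key : ∀ a b c : ZMod 2, (a ≠ 0 ∨ b ≠ 0 ∨ c ≠ 0) →
      (∀ q : FormClass 2 2, w.KillsSq q.form →
        a * q.coords 0 + b * q.coords 1 + c * q.coords 2 = 0) →
      #{q : FormClass 2 2 | w.KillsSq q.form ∧ #{l : FormClass 2 1 | l.form ∣ q.form} ≠ 1} ≤ 2 := by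
    intro a b c habc hpl
    refine (card_le_card_of_injOn FormClass.coords ?_ FormClass.coords_injective.injOn).trans
      (ZMod.card_plane_inter_ne_zero_le a b c habc)
    intro q hq
    rw [mem_coe, mem_filter] at hq ⊢
    refine ⟨mem_univ _, fun h => hq.2.2 ?_, hpl q hq.2.1⟩
    exact FormClass.card_linear_dvd_eq_one_of_coords_one_eq_zero h
  -- The two diagonals together contain all six coordinates of `w`, so `w ≠ 0` makes at least one of
  -- the linear conditions nontrivial.
  by_cases h : w.coord 0 ≠ 0 ∨ w.coord 2 ≠ 0 ∨ w.coord 4 ≠ 0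
  · exact key _ _ _ h fun q hq => (plane q hq).1
  · refine key _ _ _ ?_ fun q hq => (plane q hq).2
    by_contra h'
    push Not at h h'
    refine hw (eq_zero_of_coord fun j => ?_)
    fin_cases j
    exacts [h.1, h'.1, h.2.1, h'.2.1, h.2.2, h'.2.2]

end

open Finset in
theorem theorem1p1 (p : ℕ) [Fact p.Prime] (w : DualForm p 5) (hw : w ≠ 0)
    (hcat : DualForm.catCovariant 2 w ≠ 0) :
    ∃ C : ℤ, singularExpSum w = (C : ℂ) * (p : ℂ) ^ (-4 : ℤ) ∧ |C| ≤ 4 ∧ (p = 2 → |C| ≤ 2) := by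
  classical
  have hbound := FormClass.abs_card_sub_card_le w
  refine ⟨#{q : FormClass p 2 | w.KillsSq q.form} -
    #{x : FormClass p 1 × FormClass p 1 | w.KillsSq (x.1.form * x.2.form)}, ?_, ?_⟩
  · rw [singularExpSum_eq_card, filter_false_of_mem fun l _ => w.not_killsSq_linear hcat l]
    push_cast
    rw [card_empty]
    push_cast
    ring
  · have htwo : p = 2 → #{q : FormClass p 2 |
        w.KillsSq q.form ∧ #{l : FormClass p 1 | l.form ∣ q.form} ≠ 1} ≤ 2 := by
      rintro rfl
      exact DualForm.card_killsSq_quadratic_two_le hw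
    have hodd : p ≠ 2 → #{q : FormClass p 2 |
        w.KillsSq q.form ∧ #{l : FormClass p 1 | l.form ∣ q.form} ≠ 1} ≤ 4 := fun hp =>
      (card_le_card (monotone_filter_right _ fun q _ hq => hq.1)).trans
        (DualForm.card_killsSq_quadratic_le hp hcat)
    by_cases hp : p = 2
    · have := htwo hp
      exact ⟨by omega, fun _ => by omega⟩
    · have := hodd hp
      exact ⟨by omega, fun h => absurd h hp⟩
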